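/- Let $n\ge 1$ and let $\mathbb P$ be the uniform probability measure on $\{0,1\}^n$, ordered coordinatewise. Call $A\subset\{0,1\}^n$ monotone if $x\in A$ and $x\le y$ imply $y\in A$. For a nonempty monotone $A$, let $M_A$ be the Markov chain on $A$ which, from the state $x$, picks a coordinate $i\in\{1,\dots,n\}$ uniformly at random, replaces $x_i$ by an independent uniform bit to obtain $y$, and moves to $y$ if $y\in A$ and stays at $x$ otherwise. Let $P$ be its transition matrix and $\pi$ its stationary distribution, the uniform distribution on $A$, and let $$\tau_{mix}(M_A)=\min\Bigl\{t\ge 0:\ \max_{x\in A}\tfrac12\sum_{y\in A}|P^t(x,y)-\pi(y)|\le \tfrac14\Bigr\}$$ be its mixing time. Then $\tau_{mix}(M_A)$ is finite and $$\tau_{mix}(M_A)\ \le\ 2\Bigl(\frac{16n}{\mathbb P[A]}\Bigr)^2\log\bigl(4\cdot 2^n\,\mathbb P[A]\bigr),$$ where $\log$ is the natural logarithm. In particular, the mixing time is polynomial in $n$ whenever $\mathbb P[A]$ is at least inverse-polynomial in $n$: for every real polynomial $q$ there is a real polynomial $p$ such that for all $n\ge 1$ with $q(n)>0$ and all nonempty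 monotone $A\subset\{0,1\}^n$ with $\mathbb P[A]\ge 1/q(n)$ one has $\tau_{mix}(M_A)\le p(n)$. -/

import Mathlib

noncomputable section

/-- Total variation distance of two mass functions on a finite set. -/
def tvDist {Ω : Type*} [Fintype Ω] (μ ν : Ω → ℝ) : ℝ :=
  (1 / 2) * ∑ x, |μ x - ν x|

/-- The (worst-case) mixing time of a transition matrix `P` with stationary distribution `π`:
the least `t` such that, for every starting state `x`, the law of the chain at time `t` is within
total variation distance `1 / 4` of `π`. It is `⊤` if there is no such `t`. -/
def mixingTime {Ω : Type*} [Fintype Ω] [DecidableEq Ω] (P : Matrix Ω Ω ℝ) (π : Ω → ℝ) : ℕ∞ :=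
  ⨅ t ∈ {t : ℕ | ∀ x : Ω, tvDist ((P ^ t) x) π ≤ 1 / 4}, (t : ℕ∞)

/-- The probability of `A` under the uniform measure on `{0,1}^n`. -/
def cubeProb {n : ℕ} (A : Finset (Fin n → Bool)) : ℝ :=
  (A.card : ℝ) / 2 ^ n

/-- One move from `x ∈ A`: replace the `i`-th coordinate by `b` if the resulting point is in `A`;
otherwise stay at `x`. -/
def censoredMove {n : ℕ} (A : Finset (Fin n → Bool)) (x : A) (i : Fin n) (b : Bool) : A :=
  if h : Function.update (x : Fin n → Bool) i b ∈ A then ⟨Function.update x i b, h⟩ else x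

/-- The transition matrix of the censored chain on `A`: the coordinate `i` is uniform among the
`n` coordinates and the new value `b` is an independent fair bit. -/
def censoredChain {n : ℕ} (A : Finset (Fin n → Bool)) : Matrix A A ℝ :=
  fun x y => ∑ i : Fin n, ∑ b : Bool,
    (1 / (n : ℝ)) * (1 / 2) * (if censoredMove A x i b = y then 1 else 0)

/-- The uniform distribution on `A`. -/
def uniformOn {n : ℕ} (A : Finset (Fin n → Bool)) : A → ℝ :=
  fun _ => 1 / (A.card : ℝ)

/-- The mixing time of the censored chain on `A`. -/
def censoredMixingTime {n : ℕ} (A : Finset (Fin n → Bool)) : ℕ∞ :=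
  mixingTime (censoredChain A) (uniformOn A)

/-- The rows of the transition matrix sum to one. -/
theorem censoredChain_row_sum {n : ℕ} (hn : 0 < n) (A : Finset (Fin n → Bool)) (x : A) :
    ∑ y, censoredChain A x y = 1 := by
  have hn' : (n : ℝ) ≠ 0 := by positivity
  unfold censoredChain
  rw [Finset.sum_comm]
  have h : ∀ i : Fin n, ∑ y : A, ∑ b : Bool,
      (1 / (n : ℝ)) * (1 / 2) * (if censoredMove A x i b = y then 1 else 0) = 1 / n := by
    intro i
    rw [Finset.sum_comm]
    simp
    ring
  rw [Finset.sum_congr rfl (fun i _ => h i)]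
  simp [hn']

/-- The uniform distribution on `A` is stationary for the censored chain. -/
theorem uniformOn_stationary {n : ℕ} (hn : 0 < n) (A : Finset (Fin n → Bool)) :
    Matrix.vecMul (uniformOn A) (censoredChain A) = uniformOn A := by
  have hn' : (n : ℝ) ≠ 0 := by positivity
  -- For fixed `i`, moving and remembering the overwritten bit is an involution of `A × Bool`.
  let σ : Fin n → A × Bool → A × Bool := fun i p =>
    (censoredMove A p.1 i p.2,
      if Function.update (p.1 : Fin n → Bool) i p.2 ∈ A then (p.1 : Fin n → Bool) i else p.2)
  have hσ : ∀ i, Function.Involutive (σ i) := by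
    rintro i ⟨x, b⟩
    by_cases h : Function.update (x : Fin n → Bool) i b ∈ A <;> simp [σ, censoredMove, h]
  have key : ∀ (i : Fin n) (y : A), ∑ x : A, ∑ b : Bool,
      (if censoredMove A x i b = y then (1 : ℝ) else 0) = 2 := by
    intro i y
    rw [← Fintype.sum_prod_type' (f := fun (x : A) (b : Bool) =>
      (if censoredMove A x i b = y then (1 : ℝ) else 0))]
    refine (Equiv.sum_comp (hσ i).toPerm
      (fun p : A × Bool => if p.1 = y then (1 : ℝ) else 0)).trans ?_
    rw [Fintype.sum_prod_type]
    simp only [Fintype.sum_bool, Finset.sum_add_distrib, Finset.sum_ite_eq', Finset.mem_univ,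
      if_true]
    norm_num
  funext y
  simp only [Matrix.vecMul, dotProduct, uniformOn, censoredChain]
  rw [← Finset.mul_sum, Finset.sum_comm]
  simp only [← Finset.mul_sum, key]
  simp
  field_simp

end

/-! The core is a Poincaré inequality on the upper set `A` (`card_mul_sum_sq_le`). For mean-zero
`f`, `|A| ∑ f²` equals the sum of `posSq (f x - f y)` over all pairs in `A`. Extend `f` and `-f` to
the cube by a constant `-K` with `K ≥ |f|`, giving `F` and `h`. Then `F + h ≤ 0` on the diagonal,
and pairs not inside `A` contribute nothing off it either. Pass from `y = x` to independent `y` by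
resampling one coordinate at a time (`spliceSum_insert_le`). As in Harris' inequality, a step loses
only where `F` or `h` decreases along an edge, up to a factor close to 1. Since `A` is an upper set,
no decrease occurs along an edge whose lower end is off `A`; on edges inside `A` the losses of `f`
and `-f` add up to the squared gradient.

The chain averages the operators `(1 + flip) / 2`, so this energy controls the `ℓ²` loss per step:
squared norms contract by `1 - ℙ[A] / (8n²)`. Cauchy–Schwarz then gives mixing after `8n² / ℙ[A] *
log (4|A|)` steps, rounded up, which is below the claimed bound. -/

open Finset

section Cube

variable {n : ℕ}

/-! ### Two-point inequalities for the squared positive part. -/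

/-- The square of the positive part. -/
def posSq (t : ℝ) : ℝ := max t 0 ^ 2

theorem posSq_nonneg (t : ℝ) : 0 ≤ posSq t := sq_nonneg _

theorem posSq_of_nonpos {t : ℝ} (h : t ≤ 0) : posSq t = 0 := by
  simp [posSq, max_eq_right h]

theorem posSq_of_nonneg {t : ℝ} (h : 0 ≤ t) : posSq t = t ^ 2 := by
  simp [posSq, max_eq_left h]

theorem posSq_mono {s t : ℝ} (h : s ≤ t) : posSq s ≤ posSq t :=
  pow_le_pow_left₀ (le_max_right _ _) (max_le_max_right 0 h) 2

theorem posSq_add_posSq_neg (t : ℝ) : posSq t + posSq (-t) = t ^ 2 := by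
  rcases le_total t 0 with h | h
  · rw [posSq_of_nonpos h, posSq_of_nonneg (by linarith)]; ring
  · rw [posSq_of_nonneg h, posSq_of_nonpos (by linarith)]; ring

/-- Convexity of `posSq`, in the form of a majorization inequality. -/
theorem posSq_add_le_of_majorize {s t u w : ℝ} (hst : s ≤ t) (hsu : s ≤ u)
    (h : s + w = t + u) : posSq t + posSq u ≤ posSq s + posSq w := by
  obtain rfl : w = t + u - s := by linarith
  rcases le_total t 0 with ht | ht <;> rcases le_total u 0 with hu | hu
  · rw [posSq_of_nonpos ht, posSq_of_nonpos hu]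
    linarith [posSq_nonneg s, posSq_nonneg (t + u - s)]
  · rw [posSq_of_nonpos ht]
    linarith [posSq_nonneg s, posSq_mono (show u ≤ t + u - s by linarith)]
  · rw [posSq_of_nonpos hu]
    linarith [posSq_nonneg s, posSq_mono (show t ≤ t + u - s by linarith)]
  · rw [posSq_of_nonneg ht, posSq_of_nonneg hu, posSq_of_nonneg (t := t + u - s) (by linarith)]
    rcases le_total s 0 with hs | hs
    · rw [posSq_of_nonpos hs]
      nlinarith [mul_nonneg ht hu, mul_nonneg ht (neg_nonneg.2 hs),
        mul_nonneg hu (neg_nonneg.2 hs), sq_nonneg s]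
    · rw [posSq_of_nonneg hs]
      nlinarith [mul_nonneg (sub_nonneg.2 hst) (sub_nonneg.2 hsu)]

/-- Young's inequality with weight `θ`, after subadditivity of the positive part. -/
theorem posSq_add_le {θ : ℝ} (hθ : 0 < θ) (s t : ℝ) :
    posSq (s + t) ≤ (1 + θ) * posSq s + (1 + 1 / θ) * posSq t := by
  have h1 : max (s + t) 0 ≤ max s 0 + max t 0 :=
    max_le (add_le_add (le_max_left _ _) (le_max_left _ _))
      (add_nonneg (le_max_right _ _) (le_max_right _ _))
  have h2 : posSq (s + t) ≤ (max s 0 + max t 0) ^ 2 :=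
    pow_le_pow_left₀ (le_max_right _ _) h1 2
  refine h2.trans ?_
  unfold posSq
  generalize max s 0 = a
  generalize max t 0 = b
  have h3 : (1 + θ) * a ^ 2 + (1 + 1 / θ) * b ^ 2 - (a + b) ^ 2 = (θ * a - b) ^ 2 / θ := by
    field_simp
    ring
  have h4 : 0 ≤ (θ * a - b) ^ 2 / θ := by positivity
  linarith

/-- The two-point correlation inequality: exchanging the values of `h` increases the sum of the
`posSq (F + h)` only as far as `F` or `h` fails to be monotone. -/
theorem posSq_exchange_le {θ : ℝ} (hθ : 0 < θ) (F₀ F₁ h₀ h₁ : ℝ) :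
    posSq (F₁ + h₀) + posSq (F₀ + h₁) ≤
      (1 + θ) * (posSq (F₀ + h₀) + posSq (F₁ + h₁)) +
        (1 + 1 / θ) * (posSq (F₀ - F₁) + posSq (h₀ - h₁)) := by
  have hθ' : 0 < 1 / θ := by positivity
  have n1 := mul_nonneg hθ.le (posSq_nonneg (F₀ + h₀))
  have n2 := mul_nonneg hθ.le (posSq_nonneg (F₁ + h₁))
  have n3 := mul_nonneg hθ'.le (posSq_nonneg (F₀ - F₁))
  have n4 := mul_nonneg hθ'.le (posSq_nonneg (h₀ - h₁))
  have n5 := posSq_nonneg (F₀ - F₁)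
  have n6 := posSq_nonneg (h₀ - h₁)
  rcases le_total F₀ F₁ with hF | hF <;> rcases le_total h₀ h₁ with hh | hh
  · have := posSq_add_le_of_majorize (s := F₀ + h₀) (t := F₁ + h₀) (u := F₀ + h₁)
      (w := F₁ + h₁) (by linarith) (by linarith) (by ring)
    linarith
  · have e1 := posSq_add_le hθ (F₁ + h₁) (h₀ - h₁)
    rw [show F₁ + h₁ + (h₀ - h₁) = F₁ + h₀ by ring] at e1
    have e2 := posSq_mono (show F₀ + h₁ ≤ F₀ + h₀ by linarith)
    linarith
  · have e1 := posSq_add_le hθ (F₁ + h₁) (F₀ - F₁)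
    rw [show F₁ + h₁ + (F₀ - F₁) = F₀ + h₁ by ring] at e1
    have e2 := posSq_mono (show F₁ + h₀ ≤ F₀ + h₀ by linarith)
    linarith
  · have := posSq_add_le_of_majorize (s := F₁ + h₁) (t := F₁ + h₀) (u := F₀ + h₁)
      (w := F₀ + h₀) (by linarith) (by linarith) (by ring)
    linarith

/-! ### Interpolation on the cube from equal to independent points. -/

/-- Flip the `k`-th bit. -/
def flipBit (k : Fin n) (x : Fin n → Bool) : Fin n → Bool := Function.update x k (!x k)

theorem flipBit_involutive (k : Fin n) : Function.Involutive (flipBit k) := by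
  intro x; simp [flipBit]

theorem sum_flipBit (k : Fin n) (G : (Fin n → Bool) → ℝ) : ∑ x, G (flipBit k x) = ∑ x, G x :=
  Equiv.sum_comp (flipBit_involutive k).toPerm G

/-- The point that agrees with `y` on `S` and with `x` off `S`. -/
def splice (S : Finset (Fin n)) (x y : Fin n → Bool) : Fin n → Bool :=
  fun i => if i ∈ S then y i else x i

theorem splice_empty (x y : Fin n → Bool) : splice ∅ x y = x := by
  funext i; simp [splice]

theorem splice_univ (x y : Fin n → Bool) : splice univ x y = y := by
  funext i; simp [splice]

theorem splice_flipBit_left {S : Finset (Fin n)} {k : Fin n} (hk : k ∉ S) (x y : Fin n → Bool) :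
    splice S (flipBit k x) y = flipBit k (splice S x y) := by
  funext i
  by_cases h : i = k
  · subst h; simp [splice, flipBit, hk]
  · simp [splice, flipBit, h]

/-- Swapping the coordinates in `S` between `x` and `y` is an involution of pairs, so a splice of
uniform points is uniform. -/
theorem sum_splice (S : Finset (Fin n)) (G : (Fin n → Bool) → ℝ) :
    ∑ x, ∑ y, G (splice S x y) = 2 ^ n * ∑ x, G x := by
  have hinv : Function.Involutive
      (fun p : (Fin n → Bool) × (Fin n → Bool) => (splice S p.1 p.2, splice S p.2 p.1)) := by
    rintro ⟨x, y⟩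
    ext i <;> by_cases h : i ∈ S <;> simp [splice, h]
  have h := Equiv.sum_comp hinv.toPerm (fun p => G p.1)
  rw [Fintype.sum_prod_type, Fintype.sum_prod_type] at h
  refine Eq.trans h ?_
  simp [Finset.mul_sum]

/-- Resampling coordinate `k` keeps or flips the bit inherited from `x`, each for one of the two
values of `y k`. -/
theorem splice_insert_pair {S : Finset (Fin n)} {k : Fin n} (hk : k ∉ S) (x y : Fin n → Bool)
    (G : (Fin n → Bool) → ℝ) :
    G (splice (insert k S) x y) + G (splice (insert k S) x (flipBit k y)) =
      G (splice S x y) + G (flipBit k (splice S x y)) := by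
  have key : ∀ z : Fin n → Bool, (∀ i ∈ S, z i = y i) →
      splice (insert k S) x z = if z k = x k then splice S x y else flipBit k (splice S x y) := by
    intro z hz
    split_ifs with h
    · funext i
      by_cases hi : i = k
      · subst hi; simp [splice, h, hk]
      · by_cases hS : i ∈ S <;> simp [splice, hi, hS, hz]
    · have h' : z k = !x k := by cases h1 : z k <;> cases h2 : x k <;> simp_all
      funext i
      by_cases hi : i = k
      · subst hi; simp [splice, flipBit, h', hk]
      · by_cases hS : i ∈ S <;> simp [splice, flipBit, hi, hS, hz]
  have hf : ∀ i ∈ S, flipBit k y i = y i := by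
    intro i hi
    have : i ≠ k := fun h => hk (h ▸ hi)
    simp [flipBit, this]
  have hk' : flipBit k y k = !y k := by simp [flipBit]
  rw [key y (fun _ _ => rfl), key _ hf, hk']
  cases h1 : y k <;> cases h2 : x k <;> simp [add_comm]

/-- The size of the failure of `F` to be increasing in direction `k` at `x`. -/
def descent (F : (Fin n → Bool) → ℝ) (k : Fin n) (x : Fin n → Bool) : ℝ :=
  posSq (F (Function.update x k false) - F (Function.update x k true))

/-- The correlation of `F` and `h` when the coordinates in `S` are made independent. -/
def spliceSum (F h : (Fin n → Bool) → ℝ) (S : Finset (Fin n)) : ℝ :=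
  ∑ x, ∑ y, posSq (F x + h (splice S x y))

theorem exchange_flipBit_le {θ : ℝ} (hθ : 0 < θ) (F h : (Fin n → Bool) → ℝ) (k : Fin n)
    {x z : Fin n → Bool} (hxz : x k = z k) :
    posSq (F x + h (flipBit k z)) + posSq (F (flipBit k x) + h z) ≤
      (1 + θ) * (posSq (F x + h z) + posSq (F (flipBit k x) + h (flipBit k z))) +
        (1 + 1 / θ) * (descent F k x + descent h k z) := by
  have key := posSq_exchange_le hθ (F (Function.update x k false)) (F (Function.update x k true))
    (h (Function.update z k false)) (h (Function.update z k true))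
  unfold descent
  cases hx : x k
  · have hz : z k = false := hxz ▸ hx
    have e1 : Function.update x k false = x := by rw [← hx]; simp
    have e2 : Function.update z k false = z := by rw [← hz]; simp
    have e3 : flipBit k x = Function.update x k true := by simp [flipBit, hx]
    have e4 : flipBit k z = Function.update z k true := by simp [flipBit, hz]
    rw [e1, e2] at key
    rw [e1, e2, e3, e4]
    linarith
  · have hz : z k = true := hxz ▸ hx
    have e1 : Function.update x k true = x := by rw [← hx]; simp
    have e2 : Function.update z k true = z := by rw [← hz]; simp
    have e3 : flipBit k x = Function.update x k false := by simp [flipBit, hx]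
    have e4 : flipBit k z = Function.update z k false := by simp [flipBit, hz]
    rw [e1, e2] at key
    rw [e1, e2, e3, e4]
    linarith

theorem spliceSum_insert_le {θ : ℝ} (hθ : 0 < θ) (F h : (Fin n → Bool) → ℝ)
    {S : Finset (Fin n)} {k : Fin n} (hk : k ∉ S) :
    spliceSum F h (insert k S) ≤ (1 + θ / 2) * spliceSum F h S +
      (1 + 1 / θ) / 4 * 2 ^ n * ∑ x, (descent F k x + descent h k x) := by
  have h1 : 2 * spliceSum F h (insert k S) =
      spliceSum F h S + ∑ x, ∑ y, posSq (F x + h (flipBit k (splice S x y))) := by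
    unfold spliceSum
    rw [← Finset.sum_add_distrib, Finset.mul_sum]
    refine Finset.sum_congr rfl fun x _ => ?_
    rw [← Finset.sum_add_distrib, two_mul]
    nth_rewrite 2 [← sum_flipBit k]
    rw [← Finset.sum_add_distrib]
    exact Finset.sum_congr rfl fun y _ =>
      splice_insert_pair hk x y (fun z => posSq (F x + h z))
  -- Symmetrising under a flip of `x k` supplies both ends of each edge, as the two-point inequality
  -- requires.
  have h2 : 2 * ∑ x, ∑ y, posSq (F x + h (flipBit k (splice S x y))) =
      ∑ x, ∑ y, (posSq (F x + h (flipBit k (splice S x y))) +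
        posSq (F (flipBit k x) + h (splice S x y))) := by
    rw [two_mul]
    nth_rewrite 2 [← sum_flipBit k]
    simp only [Finset.sum_add_distrib, splice_flipBit_left hk, flipBit_involutive k _]
  have h3 : 2 * spliceSum F h S = ∑ x, ∑ y, (posSq (F x + h (splice S x y)) +
      posSq (F (flipBit k x) + h (flipBit k (splice S x y)))) := by
    rw [two_mul]
    unfold spliceSum
    nth_rewrite 2 [← sum_flipBit k]
    simp only [Finset.sum_add_distrib, splice_flipBit_left hk]
  have h4 : ∑ x, ∑ y, (posSq (F x + h (flipBit k (splice S x y))) +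
        posSq (F (flipBit k x) + h (splice S x y))) ≤
      ∑ x, ∑ y, ((1 + θ) * (posSq (F x + h (splice S x y)) +
        posSq (F (flipBit k x) + h (flipBit k (splice S x y)))) +
        (1 + 1 / θ) * (descent F k x + descent h k (splice S x y))) :=
    Finset.sum_le_sum fun x _ => Finset.sum_le_sum fun y _ =>
      exchange_flipBit_le hθ F h k (by simp [splice, hk])
  have h5 : ∑ x : Fin n → Bool, ∑ y : Fin n → Bool, (descent F k x + descent h k (splice S x y)) =
      2 ^ n * ∑ x, (descent F k x + descent h k x) := by
    simp only [Finset.sum_add_distrib, sum_splice S (descent h k)]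
    simp [Finset.mul_sum, mul_add]
  simp only [Finset.sum_add_distrib, ← Finset.mul_sum] at h2 h3 h4 h5 ⊢
  rw [h5, ← h3, ← h2] at h4
  linarith

theorem spliceSum_le (F h : (Fin n → Bool) → ℝ) {θ : ℝ} (hθ : 0 < θ)
    (hd : ∀ x, F x + h x ≤ 0) (S : Finset (Fin n)) :
    spliceSum F h S ≤ (1 + θ / 2) ^ S.card *
      ((1 + 1 / θ) / 4 * 2 ^ n * ∑ k ∈ S, ∑ x, (descent F k x + descent h k x)) := by
  induction S using Finset.induction_on with
  -- On the diagonal every term vanishes, so only the additive errors survive.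
  | empty => simp [spliceSum, splice_empty, posSq_of_nonpos (hd _)]
  | insert k S hk ih =>
    refine (spliceSum_insert_le hθ F h hk).trans ?_
    rw [Finset.sum_insert hk, Finset.card_insert_of_notMem hk]
    set c := (1 + 1 / θ) / 4 * 2 ^ n with hc
    have hc0 : 0 ≤ c := by positivity
    set a := ∑ x, (descent F k x + descent h k x) with ha
    have ha0 : 0 ≤ a :=
      Finset.sum_nonneg fun x _ => add_nonneg (posSq_nonneg _) (posSq_nonneg _)
    have h1 : (1 : ℝ) ≤ (1 + θ / 2) ^ (S.card + 1) := one_le_pow₀ (by linarith)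
    have h2 := mul_le_mul_of_nonneg_left ih (show 0 ≤ 1 + θ / 2 by linarith)
    have h3 := mul_le_mul_of_nonneg_right h1 (mul_nonneg hc0 ha0)
    calc _ ≤ _ := add_le_add h2 le_rfl
      _ ≤ _ := by rw [pow_succ] at h3 ⊢; nlinarith

/-- The correlation inequality with defect: two functions with `F + h ≤ 0` on the diagonal. -/
theorem sum_posSq_add_le (hn : 0 < n) (F h : (Fin n → Bool) → ℝ) (hd : ∀ x, F x + h x ≤ 0) :
    ∑ x, ∑ y, posSq (F x + h y) ≤
      2 * n * 2 ^ n * ∑ k, ∑ x, (descent F k x + descent h k x) := by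
  have hn' : (1 : ℝ) ≤ n := by exact_mod_cast hn
  -- With this `θ` the accumulated factor is `(1 + 1/n)^n ≤ e`, while `1 + 1/θ` stays of order `n`.
  have h1 := spliceSum_le F h (θ := 2 / n) (by positivity) hd univ
  have h2 : spliceSum F h univ = ∑ x, ∑ y, posSq (F x + h y) := by
    simp [spliceSum, splice_univ]
  rw [h2, Finset.card_univ, Fintype.card_fin] at h1
  refine h1.trans ?_
  set a := ∑ k, ∑ x, (descent F k x + descent h k x)
  have ha0 : 0 ≤ a := Finset.sum_nonneg fun k _ =>
    Finset.sum_nonneg fun x _ => add_nonneg (posSq_nonneg _) (posSq_nonneg _)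
  have h3 : (1 + 2 / (n : ℝ) / 2) ^ n ≤ 3 := by
    have := Real.add_one_le_exp (1 / (n : ℝ))
    calc (1 + 2 / (n : ℝ) / 2) ^ n ≤ (Real.exp (1 / n)) ^ n :=
          pow_le_pow_left₀ (by positivity) (by
            rw [show 2 / (n : ℝ) / 2 = 1 / n by ring]; linarith) n
      _ = Real.exp 1 := by
          rw [← Real.exp_nat_mul]; congr 1; field_simp
      _ ≤ 3 := by linarith [Real.exp_one_lt_d9]
  have h4 : (1 + 1 / (2 / (n : ℝ))) / 4 ≤ 2 * n / 3 := by
    rw [one_div_div]; linarith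
  calc _ ≤ 3 * (2 * n / 3 * 2 ^ n * a) := by gcongr
    _ = _ := by ring

end Cube

section Chain

variable {n : ℕ} {A : Finset (Fin n → Bool)}

/-! ### Censored flips and the Poincaré inequality on an upper set. -/

/-- Flip the `k`-th bit if this does not leave `A`. -/
def censoredFlip (A : Finset (Fin n → Bool)) (k : Fin n) (x : A) : A :=
  if h : flipBit k x ∈ A then ⟨flipBit k x, h⟩ else x

theorem censoredFlip_involutive (k : Fin n) : Function.Involutive (censoredFlip A k) := by
  intro x
  by_cases h : flipBit k x ∈ A
  · simp [censoredFlip, h, flipBit_involutive k (x : Fin n → Bool)]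
  · simp [censoredFlip, h]

theorem sum_censoredFlip (k : Fin n) (G : A → ℝ) : ∑ x, G (censoredFlip A k x) = ∑ x, G x :=
  Equiv.sum_comp (censoredFlip_involutive k).toPerm G

theorem sum_censoredMove (k : Fin n) (x : A) (G : A → ℝ) :
    ∑ b : Bool, G (censoredMove A x k b) = G x + G (censoredFlip A k x) := by
  have h1 : censoredMove A x k ((x : Fin n → Bool) k) = x := by simp [censoredMove]
  have h2 : censoredMove A x k (!(x : Fin n → Bool) k) = censoredFlip A k x := rfl
  rw [Fintype.sum_bool]
  cases h : (x : Fin n → Bool) k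
  · rw [h] at h1 h2
    rw [h1, ← h2, add_comm, Bool.not_false]
  · rw [h] at h1 h2
    rw [h1, ← h2, Bool.not_true]

/-- The energy of `f` in direction `k`; each edge inside `A` counts twice. -/
def edgeEnergy (k : Fin n) (f : A → ℝ) : ℝ := ∑ x, (f x - f (censoredFlip A k x)) ^ 2

/-- `f` extended by the constant `c`. -/
def extendBy (f : A → ℝ) (c : ℝ) (x : Fin n → Bool) : ℝ := if h : x ∈ A then f ⟨x, h⟩ else c

theorem extendBy_coe (f : A → ℝ) (c : ℝ) (x : A) : extendBy f c x = f x := by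
  simp [extendBy]

theorem sum_cube_eq_sum_subtype (G : (Fin n → Bool) → ℝ) (hG : ∀ x ∉ A, G x = 0) :
    ∑ x, G x = ∑ x : A, G x := by
  rw [Finset.sum_coe_sort A G]
  exact (Finset.sum_subset (Finset.subset_univ A) fun x _ hx => hG x hx).symm

theorem descent_add_descent_le (hA : IsUpperSet (A : Set (Fin n → Bool))) (f : A → ℝ) {K : ℝ}
    (hK : ∀ x, |f x| ≤ K) (k : Fin n) (x : Fin n → Bool) :
    descent (extendBy f (-K)) k x + descent (extendBy (fun y => -f y) (-K)) k x ≤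
      if h : x ∈ A then (f ⟨x, h⟩ - f (censoredFlip A k ⟨x, h⟩)) ^ 2 else 0 := by
  have hlow : ∀ (g : A → ℝ), (∀ y, |g y| ≤ K) → ∀ y, -K ≤ extendBy g (-K) y := by
    intro g hg y
    unfold extendBy
    split_ifs with h
    · exact neg_le_of_abs_le (hg _)
    · exact le_rfl
  have hK' : ∀ x, |(fun y => -f y) x| ≤ K := fun x => by simpa using hK x
  have hle : Function.update x k false ≤ Function.update x k true :=
    update_le_update_iff.2 ⟨Bool.false_le _, fun _ _ => le_rfl⟩
  by_cases h0 : Function.update x k false ∈ A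
  · have h1 : Function.update x k true ∈ A := hA hle h0
    have hd : descent (extendBy f (-K)) k x + descent (extendBy (fun y => -f y) (-K)) k x =
        (f ⟨_, h0⟩ - f ⟨_, h1⟩) ^ 2 := by
      -- The two descents are the positive and negative parts of one difference.
      rw [← posSq_add_posSq_neg]
      simp only [descent, extendBy, h0, h1, dif_pos]
      congr 2; ring
    rw [hd]
    cases hx : x k
    · have e1 : Function.update x k false = x := by rw [← hx]; simp
      have e3 : flipBit k x = Function.update x k true := by simp [flipBit, hx]
      have hxA : x ∈ A := e1 ▸ h0
      simp [hxA, censoredFlip, e1, e3, h1]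
    · have e1 : Function.update x k true = x := by rw [← hx]; simp
      have e3 : flipBit k x = Function.update x k false := by simp [flipBit, hx]
      have hxA : x ∈ A := e1 ▸ h1
      simp only [hxA, censoredFlip, e1, e3, h0, dif_pos]
      exact (sub_sq_comm _ _).le
  -- The lower end is off `A`, where both extensions take their minimum `-K`, so neither descends.
  · have e : ∀ g : A → ℝ, extendBy g (-K) (Function.update x k false) = -K := by
      intro g; simp [extendBy, h0]
    unfold descent
    rw [e, e, posSq_of_nonpos, posSq_of_nonpos, add_zero]
    · split_ifs
      · exact sq_nonneg _
      · exact le_rfl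
    · linarith [hlow _ hK' (Function.update x k true)]
    · linarith [hlow _ hK (Function.update x k true)]

/-- The Poincaré inequality on an upper set. -/
theorem card_mul_sum_sq_le (hn : 0 < n) (hA : IsUpperSet (A : Set (Fin n → Bool))) (f : A → ℝ)
    (hf : ∑ x, f x = 0) :
    (A.card : ℝ) * ∑ x, f x ^ 2 ≤ 2 * n * 2 ^ n * ∑ k, edgeEnergy k f := by
  set K := ∑ x, |f x| with hKdef
  have hK : ∀ x, |f x| ≤ K := fun x =>
    Finset.single_le_sum (f := fun x => |f x|) (fun _ _ => abs_nonneg _) (Finset.mem_univ x)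
  have hK0 : 0 ≤ K := Finset.sum_nonneg fun _ _ => abs_nonneg _
  have hd : ∀ x, extendBy f (-K) x + extendBy (fun y => -f y) (-K) x ≤ 0 := by
    intro x
    unfold extendBy
    split_ifs <;> linarith
  have key := sum_posSq_add_le hn _ _ hd
  have hleft : ∑ x, ∑ y, posSq (extendBy f (-K) x + extendBy (fun y => -f y) (-K) y) =
      ∑ x : A, ∑ y : A, posSq (f x - f y) := by
    rw [sum_cube_eq_sum_subtype (A := A)]
    · refine Finset.sum_congr rfl fun x _ => ?_
      rw [sum_cube_eq_sum_subtype (A := A)]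
      · simp only [extendBy_coe, sub_eq_add_neg]
      · intro y hy
        refine posSq_of_nonpos ?_
        rw [extendBy_coe]
        simp only [extendBy, hy, dif_neg, not_false_eq_true]
        linarith [le_of_abs_le (hK x)]
    · intro x hx
      refine Finset.sum_eq_zero fun y _ => posSq_of_nonpos ?_
      unfold extendBy
      rw [dif_neg hx]
      split_ifs with hy
      · linarith [neg_le_of_abs_le (hK ⟨y, hy⟩)]
      · linarith
  have hsym : 2 * ∑ x : A, ∑ y : A, posSq (f x - f y) = 2 * ((A.card : ℝ) * ∑ x, f x ^ 2) := by
    have h1 : 2 * ∑ x : A, ∑ y : A, posSq (f x - f y) = ∑ x : A, ∑ y : A, (f x - f y) ^ 2 := by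
      rw [two_mul]
      nth_rewrite 2 [Finset.sum_comm]
      simp only [← Finset.sum_add_distrib]
      refine Finset.sum_congr rfl fun x _ => Finset.sum_congr rfl fun y _ => ?_
      rw [← posSq_add_posSq_neg, neg_sub]
    rw [h1]
    simp only [sub_sq, Finset.sum_add_distrib, Finset.sum_sub_distrib, ← Finset.mul_sum, hf]
    simp [← Finset.mul_sum]
    ring
  have hright : ∀ k, ∑ x, (descent (extendBy f (-K)) k x +
      descent (extendBy (fun y => -f y) (-K)) k x) ≤ edgeEnergy k f := by
    intro k
    refine (Finset.sum_le_sum fun x _ => descent_add_descent_le hA f hK k x).trans ?_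
    rw [sum_cube_eq_sum_subtype (A := A) _ (fun x hx => by simp [hx])]
    simp [edgeEnergy]
  rw [hleft] at key
  have := mul_le_mul_of_nonneg_left (Finset.sum_le_sum fun k (_ : k ∈ univ) => hright k)
    (show (0 : ℝ) ≤ 2 * n * 2 ^ n by positivity)
  linarith

/-! ### One-step contraction in `ℓ²`. -/

theorem censoredChain_mulVec (f : A → ℝ) (x : A) :
    (censoredChain A).mulVec f x = (∑ k, (f x + f (censoredFlip A k x)) / 2) / n := by
  have h : ∀ k : Fin n, ∑ y : A, (∑ b : Bool, (1 / (n : ℝ)) * (1 / 2) *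
      (if censoredMove A x k b = y then 1 else 0)) * f y =
      (f x + f (censoredFlip A k x)) / 2 / n := by
    intro k
    rw [← sum_censoredMove k x f]
    simp only [Finset.sum_mul]
    rw [Finset.sum_comm]
    simp
    ring
  simp only [Matrix.mulVec, dotProduct, censoredChain, Finset.sum_mul]
  rw [Finset.sum_comm, Finset.sum_div]
  refine Finset.sum_congr rfl fun k _ => ?_
  rw [← h k]
  simp only [Finset.sum_mul]

/-- Convexity of the square over the choice of `k`, then the parallelogram identity for each `k`,
since a censored flip permutes `A`. -/
theorem sum_censoredChain_mulVec_sq_le (hn : 0 < n) (f : A → ℝ) :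
    ∑ x, ((censoredChain A).mulVec f x) ^ 2 ≤
      ∑ x, f x ^ 2 - (∑ k, edgeEnergy k f) / (4 * n) := by
  have hn' : (0 : ℝ) < n := by exact_mod_cast hn
  have h1 : ∀ x, ((censoredChain A).mulVec f x) ^ 2 ≤
      (∑ k, ((f x + f (censoredFlip A k x)) / 2) ^ 2) / n := by
    intro x
    rw [censoredChain_mulVec]
    have := sq_sum_le_card_mul_sum_sq (s := (univ : Finset (Fin n)))
      (f := fun k => (f x + f (censoredFlip A k x)) / 2)
    rw [Finset.card_univ, Fintype.card_fin] at this
    rw [div_pow, div_le_div_iff₀ (by positivity) hn']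
    nlinarith
  have h2 : ∀ k, ∑ x, ((f x + f (censoredFlip A k x)) / 2) ^ 2 =
      ∑ x, f x ^ 2 - edgeEnergy k f / 4 := by
    intro k
    have e : ∀ x, ((f x + f (censoredFlip A k x)) / 2) ^ 2 = f x ^ 2 / 2 +
        f (censoredFlip A k x) ^ 2 / 2 - (f x - f (censoredFlip A k x)) ^ 2 / 4 := by
      intro x; ring
    simp only [e, Finset.sum_add_distrib, Finset.sum_sub_distrib, ← Finset.sum_div, edgeEnergy]
    rw [sum_censoredFlip k (fun x => f x ^ 2)]
    ring
  refine (Finset.sum_le_sum fun x _ => h1 x).trans (le_of_eq ?_)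
  rw [← Finset.sum_div, Finset.sum_comm]
  simp only [h2, Finset.sum_sub_distrib, ← Finset.sum_div]
  simp
  field_simp

/-- The spectral gap bound: one step contracts the `ℓ²` norm of mean-zero functions. -/
theorem sum_censoredChain_mulVec_sq_le_mul (hn : 0 < n)
    (hA : IsUpperSet (A : Set (Fin n → Bool))) (f : A → ℝ) (hf : ∑ x, f x = 0) :
    ∑ x, ((censoredChain A).mulVec f x) ^ 2 ≤
      (1 - cubeProb A / (8 * n ^ 2)) * ∑ x, f x ^ 2 := by
  have hn' : (0 : ℝ) < n := by exact_mod_cast hn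
  refine (sum_censoredChain_mulVec_sq_le hn f).trans ?_
  have h := card_mul_sum_sq_le hn hA f hf
  rw [sub_mul, one_mul]
  have h2 : cubeProb A / (8 * n ^ 2) * ∑ x, f x ^ 2 =
      ((A.card : ℝ) * ∑ x, f x ^ 2) / (8 * n ^ 2 * 2 ^ n) := by
    unfold cubeProb; field_simp
  have h3 : (∑ k, edgeEnergy k f) / (4 * n) =
      (2 * n * 2 ^ n * ∑ k, edgeEnergy k f) / (8 * n ^ 2 * 2 ^ n) := by
    field_simp; ring
  rw [h2, h3]
  gcongr

/-! ### Decay of the powers and the mixing time. -/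

theorem censoredChain_isSymm : (censoredChain A).IsSymm := by
  ext x y
  simp only [Matrix.transpose_apply, censoredChain, ← Finset.mul_sum]
  congr 1
  refine Finset.sum_congr rfl fun k _ => ?_
  rw [sum_censoredMove k y (fun z => if z = x then (1 : ℝ) else 0),
    sum_censoredMove k x (fun z => if z = y then (1 : ℝ) else 0)]
  simp only [eq_comm (a := y), (censoredFlip_involutive k).eq_iff]

theorem sum_censoredChain_pow (hn : 0 < n) (t : ℕ) (x : A) :
    ∑ y, (censoredChain A ^ t) x y = 1 := by
  induction t generalizing x with
  | zero => simp [Matrix.one_apply]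
  | succ t ih =>
    simp only [pow_succ', Matrix.mul_apply]
    rw [Finset.sum_comm]
    simp only [← Finset.mul_sum, ih, mul_one]
    exact censoredChain_row_sum hn A x

theorem sum_censoredChain_pow_sub_sq_le (hn : 0 < n) (hne : A.Nonempty)
    (hA : IsUpperSet (A : Set (Fin n → Bool))) (hγ : 0 ≤ 1 - cubeProb A / (8 * n ^ 2)) (t : ℕ)
    (x : A) :
    ∑ y, ((censoredChain A ^ t) x y - uniformOn A y) ^ 2 ≤
      (1 - cubeProb A / (8 * n ^ 2)) ^ t := by
  have hc : (0 : ℝ) < A.card := by exact_mod_cast hne.card_pos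
  have hmean : ∀ t, ∑ y, ((censoredChain A ^ t) x y - uniformOn A y) = 0 := by
    intro t
    rw [Finset.sum_sub_distrib, sum_censoredChain_pow hn]
    simp [uniformOn, hc.ne']
  induction t with
  | zero =>
    have h1 := hmean 0
    -- An indicator is its own square; the total is `1 - 1/|A| ≤ 1`.
    have e : ∀ y, ((censoredChain A ^ 0) x y - uniformOn A y) ^ 2 =
        (censoredChain A ^ 0) x y * (1 - uniformOn A y) -
          uniformOn A x * ((censoredChain A ^ 0) x y - uniformOn A y) := by
      intro y
      simp only [pow_zero, Matrix.one_apply, uniformOn]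
      split_ifs <;> ring
    simp only [e]
    rw [Finset.sum_sub_distrib, ← Finset.mul_sum, h1]
    have : 0 ≤ uniformOn A x := by unfold uniformOn; positivity
    simp [Matrix.one_apply, this]
  | succ t ih =>
    set f : A → ℝ := fun y => (censoredChain A ^ t) x y - uniformOn A y with hf
    have hstep : ∀ y, (censoredChain A ^ (t + 1)) x y - uniformOn A y =
        (censoredChain A).mulVec f y := by
      -- By symmetry the law, a row vector, evolves as a function does, so the contraction applies.
      have e : (censoredChain A).mulVec f = Matrix.vecMul f (censoredChain A) := by
        conv_lhs => rw [← (censoredChain_isSymm (A := A)).eq]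
        exact Matrix.mulVec_transpose _ _
      have e2 : f = (censoredChain A ^ t) x - uniformOn A := rfl
      intro y
      rw [e, e2, Matrix.sub_vecMul, uniformOn_stationary hn, pow_succ]
      rfl
    simp only [hstep]
    refine (sum_censoredChain_mulVec_sq_le_mul hn hA f (hmean t)).trans ?_
    rw [pow_succ' (1 - cubeProb A / (8 * (n : ℝ) ^ 2))]
    exact mul_le_mul_of_nonneg_left ih hγ

theorem cubeProb_pos (hne : A.Nonempty) : 0 < cubeProb A := by
  have : (0 : ℝ) < A.card := by exact_mod_cast hne.card_pos
  unfold cubeProb; positivity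

theorem cubeProb_le_one (A : Finset (Fin n → Bool)) : cubeProb A ≤ 1 := by
  have h : A.card ≤ 2 ^ n := by simpa using A.card_le_univ
  unfold cubeProb
  rw [div_le_one (by positivity)]
  exact_mod_cast h

theorem tvDist_censoredChain_le (hn : 0 < n) (hne : A.Nonempty)
    (hA : IsUpperSet (A : Set (Fin n → Bool))) {t : ℕ}
    (ht : 8 * n ^ 2 / cubeProb A * Real.log (4 * A.card) ≤ t) (x : A) :
    tvDist ((censoredChain A ^ t) x) (uniformOn A) ≤ 1 / 4 := by
  have hn' : (1 : ℝ) ≤ n := by exact_mod_cast hn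
  have hc : (0 : ℝ) < A.card := by exact_mod_cast hne.card_pos
  have hp := cubeProb_pos hne
  set γ := cubeProb A / (8 * n ^ 2) with hγdef
  have hγ0 : 0 < γ := by positivity
  have hγ : 0 ≤ 1 - γ := by
    rw [sub_nonneg, hγdef, div_le_one (by positivity)]
    nlinarith [cubeProb_le_one A]
  have h1 := sum_censoredChain_pow_sub_sq_le hn hne hA hγ t x
  have h2 : (1 - γ) ^ t ≤ 1 / (4 * A.card) := by
    have hlog : Real.log (4 * A.card) ≤ t * γ := by
      have e : Real.log (4 * A.card) = 8 * n ^ 2 / cubeProb A * Real.log (4 * A.card) * γ := by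
        rw [hγdef]; field_simp
      rw [e]
      exact mul_le_mul_of_nonneg_right ht hγ0.le
    calc (1 - γ) ^ t ≤ Real.exp (-γ) ^ t :=
          pow_le_pow_left₀ hγ (by linarith [Real.add_one_le_exp (-γ)]) t
      _ = Real.exp (-(t * γ)) := by rw [← Real.exp_nat_mul]; congr 1; ring
      _ ≤ Real.exp (-Real.log (4 * A.card)) := Real.exp_le_exp.2 (by linarith)
      _ = 1 / (4 * A.card) := by
          rw [Real.exp_neg, Real.exp_log (by positivity), one_div]
  have h3 : (∑ y, |(censoredChain A ^ t) x y - uniformOn A y|) ^ 2 ≤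
      A.card * ∑ y, ((censoredChain A ^ t) x y - uniformOn A y) ^ 2 := by
    have := sq_sum_le_card_mul_sum_sq (s := (univ : Finset A))
      (f := fun y => |(censoredChain A ^ t) x y - uniformOn A y|)
    simpa only [sq_abs, Finset.card_univ, Fintype.card_coe] using this
  have h4 : (∑ y, |(censoredChain A ^ t) x y - uniformOn A y|) ^ 2 ≤ (1 / 2) ^ 2 := by
    refine h3.trans ((mul_le_mul_of_nonneg_left (h1.trans h2) hc.le).trans (le_of_eq ?_))
    field_simp; norm_num
  have h5 := le_of_sq_le_sq h4 (by norm_num)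
  unfold tvDist
  linarith

theorem exists_mixingTime_eq {Ω : Type*} [Fintype Ω] [DecidableEq Ω] {P : Matrix Ω Ω ℝ}
    {π : Ω → ℝ} {t : ℕ} (ht : ∀ x, tvDist ((P ^ t) x) π ≤ 1 / 4) :
    ∃ τ : ℕ, mixingTime P π = τ ∧ τ ≤ t := by
  have h : mixingTime P π ≤ t := iInf₂_le t ht
  obtain ⟨τ, hτ⟩ := ENat.ne_top_iff_exists.1 (ne_top_of_le_ne_top (ENat.natCast_ne_top t) h)
  exact ⟨τ, hτ.symm, by rw [← hτ] at h; exact_mod_cast h⟩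

theorem censoredMixingTime_le (hn : 0 < n) (hne : A.Nonempty)
    (hA : IsUpperSet (A : Set (Fin n → Bool))) :
    ∃ τ : ℕ, censoredMixingTime A = (τ : ℕ∞) ∧
      (τ : ℝ) ≤ 2 * (16 * (n : ℝ) / cubeProb A) ^ 2 *
        Real.log (4 * 2 ^ n * cubeProb A) := by
  have hn' : (1 : ℝ) ≤ n := by exact_mod_cast hn
  have hc : (1 : ℝ) ≤ A.card := by exact_mod_cast hne.card_pos
  have hp := cubeProb_pos hne
  have hp1 := cubeProb_le_one A
  have hcard : (4 * 2 ^ n * cubeProb A : ℝ) = 4 * A.card := by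
    unfold cubeProb; field_simp
  have hlog : 1 ≤ Real.log (4 * A.card) := by
    rw [Real.le_log_iff_exp_le (by positivity)]
    linarith [Real.exp_one_lt_d9]
  set L := Real.log (4 * A.card) with hL
  obtain ⟨τ, h1, h2⟩ := exists_mixingTime_eq
    (tvDist_censoredChain_le hn hne hA (Nat.le_ceil (8 * n ^ 2 / cubeProb A * L)))
  refine ⟨τ, h1, ?_⟩
  rw [hcard, ← hL]
  have h3 : (τ : ℝ) ≤ ⌈8 * n ^ 2 / cubeProb A * L⌉₊ := by exact_mod_cast h2
  have h4 := Nat.ceil_lt_add_one (show 0 ≤ 8 * n ^ 2 / cubeProb A * L by positivity)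
  set r := 1 / cubeProb A with hr
  have hr1 : 1 ≤ r := by rw [hr, le_div_iff₀ hp]; linarith
  have e1 : 8 * (n : ℝ) ^ 2 / cubeProb A * L = 8 * (n ^ 2 * r * L) := by rw [hr]; ring
  have e2 : 2 * (16 * (n : ℝ) / cubeProb A) ^ 2 * L = 512 * (n ^ 2 * r * L) * r := by
    rw [hr]; ring
  -- This absorbs the `+ 1` from rounding up: `8 + 1 ≤ 512`, and `r ≥ 1` pays for the extra `1 /
  -- ℙ[A]`.
  have h5 : 1 ≤ (n : ℝ) ^ 2 * r * L :=
    one_le_mul_of_one_le_of_one_le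
      (one_le_mul_of_one_le_of_one_le (one_le_pow₀ hn') hr1) hlog
  rw [e1] at h3 h4
  rw [e2]
  nlinarith

end Chain

theorem corollary2 :
    (∀ (n : ℕ) (A : Finset (Fin n → Bool)), 0 < n → A.Nonempty →
      IsUpperSet (A : Set (Fin n → Bool)) →
        ∃ τ : ℕ, censoredMixingTime A = (τ : ℕ∞) ∧
          (τ : ℝ) ≤ 2 * (16 * (n : ℝ) / cubeProb A) ^ 2 *
            Real.log (4 * 2 ^ n * cubeProb A)) ∧
    (∀ q : Polynomial ℝ, ∃ p : Polynomial ℝ,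
      ∀ (n : ℕ) (A : Finset (Fin n → Bool)), 0 < n → A.Nonempty →
        IsUpperSet (A : Set (Fin n → Bool)) →
          0 < q.eval (n : ℝ) → 1 / q.eval (n : ℝ) ≤ cubeProb A →
            ∃ τ : ℕ, censoredMixingTime A = (τ : ℕ∞) ∧ (τ : ℝ) ≤ p.eval (n : ℝ)) := by
  refine ⟨fun n A hn hne hA => censoredMixingTime_le hn hne hA, fun q => ?_⟩
  -- `512 = 2 * 16²`, `q` bounds `1 / ℙ[A]`, and the logarithm is at most `(n + 2) log 2 ≤ n + 2`.
  refine ⟨Polynomial.C 512 * Polynomial.X ^ 2 * q ^ 2 * (Polynomial.X + Polynomial.C 2), ?_⟩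
  intro n A hn hne hA hq hqA
  obtain ⟨τ, h1, h2⟩ := censoredMixingTime_le hn hne hA
  refine ⟨τ, h1, h2.trans ?_⟩
  have hp := cubeProb_pos hne
  have hp1 := cubeProb_le_one A
  have hinv : 1 / cubeProb A ≤ q.eval (n : ℝ) := by
    rw [div_le_iff₀ hp]
    rwa [div_le_iff₀' hq] at hqA
  have hlog : Real.log (4 * 2 ^ n * cubeProb A) ≤ n + 2 := by
    have h3 : Real.log (4 * 2 ^ n * cubeProb A) ≤ Real.log (2 ^ (n + 2)) := by
      refine Real.log_le_log (by positivity) ?_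
      have : (4 * 2 ^ n : ℝ) = 2 ^ (n + 2) := by ring
      rw [← this]
      exact mul_le_of_le_one_right (by positivity) hp1
    rw [Real.log_pow] at h3
    have h4 := Real.log_two_lt_d9
    push_cast at h3
    nlinarith [(Nat.cast_nonneg n : (0 : ℝ) ≤ n)]
  have e : 2 * (16 * (n : ℝ) / cubeProb A) ^ 2 = 512 * n ^ 2 * (1 / cubeProb A) ^ 2 := by ring
  simp only [Polynomial.eval_mul, Polynomial.eval_C, Polynomial.eval_pow, Polynomial.eval_X,
    Polynomial.eval_add]
  rw [e]
  refine (mul_le_mul_of_nonneg_left hlog (by positivity)).trans ?_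
  gcongr
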